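/- Logarithms are to base $2$, and $\|A\|_1 = \operatorname{Tr}\sqrt{A^*A}$. Ensembles. Let $k,m,n$ be positive integers such that $k$ divides $m$ and $n$. For each $i\in[n/k]$ let $B_i$ be an orthonormal basis of $\mathbb{C}^m$, partitioned into $k$ sets $B_{i1},\dots,B_{ik}$ of equal size $m/k$, and let $\rho_{ij} = \frac{k}{m}\sum_{|v\rangle\in B_{ij}} |v\rangle\langle v|$. The ensemble consists of the $n$ states $\rho_{ij}$, $i\in[n/k]$, $j\in[k]$, each with probability $1/n$. Protocols. A (one-shot) one-way protocol for the visible compression of the ensemble consists of finite-dimensional registers $E_A,E_B,A_1,M,B_1$, a unit vector $|\phi\rangle\in E_A\otimes E_B$, an isometry $U_{ij}:E_A\to A_1\otimes M$ for every input $(i,j)$, and an isometry $V:E_B\otimes M\to B_1\otimes\mathbb{C}^m$. On input $(i,j)$ Alice applies $U_{ij}$ to her part of $|\phi\rangle$ and sends $M$ to Bob, who applies $V$; the output $\tilde\rho_{ij}$ is the resulting state of the register $\mathbb{C}^m$. The protocol is with shared entanglement if the Schmidt rank of $|\phi\rangle$ is more than $1$; its quantum communication is $\log\dim M$; its average error is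 $\frac1n\sum_{i,j}\|\rho_{ij}-\tilde\rho_{ij}\|_1$. Proposition. There is a universal constant $C>0$ such that for all positive integers $k,m,n$ with $k$ dividing $m$ and $n$, every $\epsilon>0$ and every ensemble as above, there is a one-way protocol with shared entanglement for the visible compression of the ensemble, with average error at most $\epsilon$ and with quantum communication at most \[ \tfrac12\log k + C\,\log\log\max\{4,\tfrac1\epsilon\}. \] (Thus the quantum communication is $\frac12\log k+O(\log\log\frac1\epsilon)$; for $\epsilon\le\frac14$ the maximum is $\frac1\epsilon$.) -/

import Mathlib

open scoped Matrix

noncomputable section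

/-- The trace norm `Tr √(M* M)` of a complex square matrix. -/
def traceNorm {ι : Type*} [Fintype ι] [DecidableEq ι] (M : Matrix ι ι ℂ) : ℝ :=
  open scoped MatrixOrder in (CFC.sqrt (Mᴴ * M)).trace.re

/-- A one-way protocol (one message, from Alice to Bob), in which Alice has a classical input
`x : X` and Bob has no input. A register is a finite type, its state space being the complex
vector space with that type as canonical basis. Alice's input register is read-only, so that her
isometry is `∑ x, |x⟩⟨x| ⊗ U x`. Bob's output register is `Bout`. -/
structure OneWayProtocol (X Bout : Type) [Fintype Bout] where
  /-- Alice's work register -/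
  EA : Type
  /-- Bob's work register -/
  EB : Type
  /-- the register that Alice keeps -/
  A1 : Type
  /-- the message register -/
  M : Type
  /-- the register that Bob keeps besides his output -/
  B1 : Type
  [fintypeEA : Fintype EA]
  [fintypeEB : Fintype EB]
  [fintypeA1 : Fintype A1]
  [fintypeM : Fintype M]
  [fintypeB1 : Fintype B1]
  [decEqEA : DecidableEq EA]
  [decEqEB : DecidableEq EB]
  [decEqM : DecidableEq M]
  /-- the initial pure state of the two work registers -/
  φ : EuclideanSpace ℂ (EA × EB)
  norm_φ : ‖φ‖ = 1
  /-- Alice's operation on input `x` -/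
  U : X → Matrix (A1 × M) EA ℂ
  isometry_U : ∀ x, (U x)ᴴ * U x = 1
  /-- Bob's operation -/
  V : Matrix (B1 × Bout) (EB × M) ℂ
  isometry_V : Vᴴ * V = 1

namespace OneWayProtocol

attribute [instance] fintypeEA fintypeEB fintypeA1 fintypeM fintypeB1 decEqEA decEqEB decEqM

variable {X Bout : Type} [Fintype Bout] (P : OneWayProtocol X Bout)

/-- The joint pure state `(U x ⊗ 1) φ` after Alice has applied her isometry. -/
def afterAlice (x : X) (a : P.A1) (μ : P.M) (e : P.EB) : ℂ :=
  ∑ s : P.EA, P.U x (a, μ) s * P.φ (s, e)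

/-- The joint pure state `(1 ⊗ V) (U x ⊗ 1) φ` at the end of the protocol. -/
def finalState (x : X) (a : P.A1) (b : P.B1) (o : Bout) : ℂ :=
  ∑ e : P.EB, ∑ μ : P.M, P.V (b, o) (e, μ) * P.afterAlice x a μ e

/-- The state of Bob's output register on input `x`: the partial trace of the final state
over the registers `A1` and `B1`. -/
def output (x : X) : Matrix Bout Bout ℂ :=
  Matrix.of fun o o' =>
    ∑ a : P.A1, ∑ b : P.B1, P.finalState x a b o * star (P.finalState x a b o')

/-- The length of the message in qubits. -/
def communicationCost : ℝ := Real.logb 2 (Fintype.card P.M)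

/-- The Schmidt rank of the initial state across the two work registers. -/
def schmidtRank : ℕ := (Matrix.of fun (s : P.EA) (e : P.EB) => P.φ (s, e)).rank

/-- The protocol is entanglement-assisted. -/
def HasSharedEntanglement : Prop := 1 < P.schmidtRank

/-- The average error, in trace distance, of the protocol as a visible compression protocol for
the ensemble `((p x, ρ x) : x ∈ X)`. -/
def averageError [Fintype X] [DecidableEq Bout] (p : X → ℝ) (ρ : X → Matrix Bout Bout ℂ) : ℝ :=
  ∑ x, p x * traceNorm (ρ x - P.output x)

end OneWayProtocol

/-- The data of an ensemble of the Jain–Radhakrishnan–Sen form: `n / k` orthonormal bases of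
`ℂ^m`, each with an ordered partition into `k` blocks of equal size. The vector `basis i v` lies
in the block with index `block i v`. -/
structure JRSEnsemble (k m n : ℕ) where
  basis : Fin (n / k) → OrthonormalBasis (Fin m) ℂ (EuclideanSpace ℂ (Fin m))
  block : Fin (n / k) → Fin m → Fin k
  card_block : ∀ i j, k * (Finset.univ.filter fun v => block i v = j).card = m

/-- The state `ρ_{ij} = (k / m) ∑ |v⟩⟨v|`, the sum being over the `j`-th block of the
`i`-th basis. -/
def JRSEnsemble.state {k m n : ℕ} (E : JRSEnsemble k m n) (x : Fin (n / k) × Fin k) :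
    Matrix (Fin m) (Fin m) ℂ :=
  ((k : ℂ) / (m : ℂ)) • ∑ v ∈ Finset.univ.filter (fun v => E.block x.1 v = x.2),
    Matrix.vecMulVec (fun r => E.basis x.1 v r) (fun r => star (E.basis x.1 v r))

end

/-! Alice and Bob share `d ^ 2` maximally entangled pairs of local dimension `m`. If Alice measures
her halves in the conjugate of `B_i`, Bob's halves become independent uniform vectors of `B_i`, with
outcomes known to her. She names a pair whose outcome lies in block `j`. By symmetry within the
block, that half is exactly `ρ_ij`, given that such a pair exists. All pairs miss the block with
probability `(1 - 1/k) ^ (d ^ 2)`, and the error is exactly twice this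
(`JRSEnsemble.traceNorm_state_sub_output`).

A label is one of `d ^ 2` values, so superdense coding over one more pair sends it in a message of
dimension `d`. With `L = log max(4, 1/ε)` and `d = ⌈√(2kL)⌉`, the error is at most `ε`, while `log
d` is `(1/2) log k + O(log L)`. -/

noncomputable section

/-! ### Heisenberg–Weyl operators, the code for superdense coding. -/

section Weyl

variable {d : ℕ} [NeZero d]

/-- The matrix entries of the Heisenberg–Weyl (generalized Pauli) operator with label `l`:
a modulation by `l.2` followed by a shift by `l.1`. -/
def weyl (l : ZMod d × ZMod d) (μ c : ZMod d) : ℂ :=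
  if μ = c + l.1 then ZMod.stdAddChar (c * l.2) else 0

theorem star_stdAddChar_mul_self (a : ZMod d) :
    star (ZMod.stdAddChar a : ℂ) * ZMod.stdAddChar a = 1 := by
  rw [← starRingEnd_apply, ← AddChar.map_neg_eq_conj, ← AddChar.map_add_eq_mul]
  simp

theorem star_stdAddChar_mul (a b : ZMod d) :
    star (ZMod.stdAddChar a : ℂ) * ZMod.stdAddChar b = ZMod.stdAddChar (b - a) := by
  rw [← starRingEnd_apply, ← AddChar.map_neg_eq_conj, ← AddChar.map_add_eq_mul]
  congr 1; ring

theorem sum_stdAddChar_mul (b : ZMod d) :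
    ∑ x : ZMod d, (ZMod.stdAddChar (x * b) : ℂ) = if b = 0 then (d : ℂ) else 0 := by
  rw [AddChar.sum_mulShift b (ZMod.isPrimitive_stdAddChar d)]
  split_ifs <;> simp [ZMod.card]

theorem weyl_isometry (l : ZMod d × ZMod d) (c c' : ZMod d) :
    ∑ μ, star (weyl l μ c) * weyl l μ c' = if c = c' then 1 else 0 := by
  rw [Finset.sum_eq_single (c + l.1)]
  · by_cases h : c = c'
    · subst h; simp only [weyl, if_true, star_stdAddChar_mul_self]
    · simp [weyl, h]
  · intro μ _ hμ; simp [weyl, hμ]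
  · simp

/-- Different labels yield orthogonal Bell states, so Bob decodes without error. -/
theorem weyl_trace_orthogonal (l l' : ZMod d × ZMod d) :
    ∑ c, ∑ μ, star (weyl l μ c) * weyl l' μ c = if l = l' then (d : ℂ) else 0 := by
  have h : ∀ c, ∑ μ, star (weyl l μ c) * weyl l' μ c =
      if l.1 = l'.1 then (ZMod.stdAddChar (c * (l'.2 - l.2)) : ℂ) else 0 := by
    intro c
    rw [Finset.sum_eq_single (c + l.1)]
    · by_cases h : l.1 = l'.1
      · simp only [weyl, h, if_true, star_stdAddChar_mul]; congr 1; ring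
      · simp [weyl, h]
    · intro μ _ hμ; simp [weyl, hμ]
    · simp
  simp_rw [h]
  by_cases h1 : l.1 = l'.1
  · simp only [h1, if_true, sum_stdAddChar_mul, Prod.ext_iff, true_and, sub_eq_zero]
    simp only [eq_comm]
  · simp [h1, Prod.ext_iff]

/-- The Bell states span, which makes Bob's decoding an isometry. Only the shift `μ - c`
contributes; the character sum over modulations then forces `c = c'`. -/
theorem weyl_complete (μ c μ' c' : ZMod d) :
    ∑ l, weyl l μ c * star (weyl l μ' c') = if c = c' ∧ μ = μ' then (d : ℂ) else 0 := by
  rw [Fintype.sum_prod_type, Finset.sum_eq_single (μ - c)]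
  · by_cases h : μ' = c' + (μ - c)
    · have : ∀ x : ZMod d, weyl (μ - c, x) μ c * star (weyl (μ - c, x) μ' c') =
          ZMod.stdAddChar (x * (c - c')) := by
        intro x
        simp only [weyl, ← h, add_sub_cancel, if_true]
        rw [mul_comm, star_stdAddChar_mul]; congr 1; ring
      simp_rw [this, sum_stdAddChar_mul, sub_eq_zero]
      refine if_congr ⟨fun hc => ⟨hc, ?_⟩, fun hc => hc.1⟩ rfl rfl
      rw [h, hc]; ring
    · have : ¬ (c = c' ∧ μ = μ') := by
        rintro ⟨rfl, rfl⟩; exact h (by ring)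
      simp [weyl, h, this]
  · intro a _ ha
    have : μ ≠ c + a := fun h => ha (by rw [h]; ring)
    simp [weyl, this]
  · simp

end Weyl

/-! ### Tensor powers of an orthonormal basis. -/

section ProductBasis

variable {ι κ : Type*} [Fintype ι] [DecidableEq ι] [Fintype κ]

/-- Parseval's identity for two standard basis vectors. -/
theorem OrthonormalBasis.sum_star_mul [DecidableEq κ]
    (b : OrthonormalBasis κ ℂ (EuclideanSpace ℂ κ))
    (s s' : κ) : ∑ v, star (b v s) * b v s' = if s = s' then 1 else 0 := by
  have h := b.sum_inner_mul_inner (EuclideanSpace.single s' 1) (EuclideanSpace.single s 1)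
  simp only [EuclideanSpace.inner_single_left, EuclideanSpace.inner_single_right] at h
  simp only [map_one, one_mul, starRingEnd_apply, PiLp.single_apply] at h
  rw [← Finset.sum_congr rfl fun v _ => mul_comm (b v s') (star (b v s)), h]
  split_ifs <;> simp

theorem OrthonormalBasis.sum_mul_star [DecidableEq κ]
    (b : OrthonormalBasis κ ℂ (EuclideanSpace ℂ κ))
    (v w : κ) : ∑ s, star (b v s) * b w s = if v = w then 1 else 0 := by
  have h := orthonormal_iff_ite.mp b.orthonormal v w
  rw [← h, PiLp.inner_apply]
  exact Finset.sum_congr rfl fun s _ => by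
    simp [mul_comm]

/-- The entries of the tensor product basis of `(ℂ^κ)^{⊗ ι}`. -/
def productBasis (b : OrthonormalBasis κ ℂ (EuclideanSpace ℂ κ)) (u s : ι → κ) : ℂ :=
  ∏ l, b (u l) (s l)

theorem productBasis_complete [DecidableEq κ]
    (b : OrthonormalBasis κ ℂ (EuclideanSpace ℂ κ))
    (s s' : ι → κ) :
    ∑ u, star (productBasis b u s) * productBasis b u s' = if s = s' then 1 else 0 := by
  simp_rw [productBasis, star_prod, ← Finset.prod_mul_distrib]
  rw [← Fintype.prod_sum fun l v => star (b v (s l)) * b v (s' l)]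
  simp_rw [OrthonormalBasis.sum_star_mul]
  rw [Fintype.prod_ite_zero]
  simp [funext_iff]

/-- The tensor product vector at a configuration split into its `l`-th entry and the rest. -/
theorem productBasis_funSplitAt_symm (b : OrthonormalBasis κ ℂ (EuclideanSpace ℂ κ))
    (u : ι → κ) (l : ι) (o : κ) (z : {l' // l' ≠ l} → κ) :
    productBasis b u ((Equiv.funSplitAt l κ).symm (o, z)) =
      b (u l) o * ∏ l' : {l' // l' ≠ l}, b (u l') (z l') := by
  rw [productBasis, Fintype.prod_eq_mul_prod_subtype_ne _ l]
  congr 1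
  · simp [Equiv.funSplitAt, Equiv.piSplitAt]
  · refine Finset.prod_congr rfl fun l' _ => ?_
    simp [Equiv.funSplitAt, Equiv.piSplitAt, l'.2]

/-- Tracing out all tensor factors but the `l`-th one. -/
theorem sum_productBasis_funSplitAt [DecidableEq κ]
    (b : OrthonormalBasis κ ℂ (EuclideanSpace ℂ κ))
    (u : ι → κ) (l : ι) (o o' : κ) :
    ∑ z : {l' // l' ≠ l} → κ, productBasis b u ((Equiv.funSplitAt l κ).symm (o, z)) *
        star (productBasis b u ((Equiv.funSplitAt l κ).symm (o', z))) =
      b (u l) o * star (b (u l) o') := by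
  simp_rw [productBasis_funSplitAt_symm, star_mul', star_prod, mul_mul_mul_comm,
    ← Finset.prod_mul_distrib, ← Finset.mul_sum]
  rw [← Fintype.prod_sum fun (l' : {l' // l' ≠ l}) v => b (u l') v * star (b (u l') v)]
  have : ∀ l' : {l' // l' ≠ l}, ∑ v, b (u l') v * star (b (u l') v) = 1 := fun l' => by
    rw [Finset.sum_congr rfl fun v _ => mul_comm _ _, OrthonormalBasis.sum_mul_star]; simp
  simp_rw [this, Finset.prod_const_one, mul_one]

theorem sum_funSplitAt_symm {R : Type*} [AddCommMonoid R] (l : ι) (g : (ι → κ) → R) :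
    ∑ z : {l' // l' ≠ l} → κ, ∑ o, g ((Equiv.funSplitAt l κ).symm (o, z)) = ∑ y, g y := by
  rw [Finset.sum_comm, ← Fintype.sum_prod_type' fun o z => g ((Equiv.funSplitAt l κ).symm (o, z))]
  exact Equiv.sum_comp (Equiv.funSplitAt l κ).symm g

end ProductBasis

/-! ### The measure-and-select protocol and its output. -/

section Protocol

variable {X : Type} {m d : ℕ} [NeZero m] [NeZero d]

/-- The protocol in which Alice and Bob share `d ^ 2` maximally entangled states of local
dimension `m`, indexed by the labels of the Weyl operators, and one of local dimension `d`. On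
input `x` Alice measures all her halves of the former in the (conjugate) basis `b x`, and from
the outcomes `u` selects the label `t x u`, which she communicates by superdense coding. Bob
outputs his half of the pair with this label. -/
def measureAndSelect (b : X → OrthonormalBasis (Fin m) ℂ (EuclideanSpace ℂ (Fin m)))
    (t : X → (ZMod d × ZMod d → Fin m) → ZMod d × ZMod d) : OneWayProtocol X (Fin m) where
  EA := (ZMod d × ZMod d → Fin m) × ZMod d
  EB := (ZMod d × ZMod d → Fin m) × ZMod d
  A1 := ZMod d × ZMod d → Fin m
  M := ZMod d
  B1 := Σ l : ZMod d × ZMod d, ({l' // l' ≠ l} → Fin m)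
  φ := WithLp.toLp 2 fun q => if q.1 = q.2 then
    (((√((m : ℝ) ^ (d * d) * d))⁻¹ : ℝ) : ℂ) else 0
  norm_φ := by
    have hm : (0 : ℝ) < m := by exact_mod_cast Nat.pos_of_neZero m
    have hd : (0 : ℝ) < d := by exact_mod_cast Nat.pos_of_neZero d
    have h : (0 : ℝ) < (m : ℝ) ^ (d * d) * d := by positivity
    rw [EuclideanSpace.norm_eq, Real.sqrt_eq_one, Fintype.sum_prod_type]
    have : ∀ s e : (ZMod d × ZMod d → Fin m) × ZMod d,
        ‖(if s = e then (((√((m : ℝ) ^ (d * d) * d))⁻¹ : ℝ) : ℂ) else 0)‖ ^ 2 =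
          if s = e then ((m : ℝ) ^ (d * d) * d)⁻¹ else 0 := by
      intro s e
      split_ifs
      · rw [Complex.norm_real, Real.norm_eq_abs, sq_abs, inv_pow, Real.sq_sqrt h.le]
      · simp
    simp only [this]
    simp [ZMod.card]
    field_simp
  -- The unconjugated entry is the bra of the conjugate basis vector, so Bob's halves collapse to
  -- the vectors of `b x` themselves.
  U x := Matrix.of fun p s => productBasis (b x) p.1 s.1 * weyl (t x p.1) p.2 s.2
  isometry_U x := by
    ext ⟨s, c⟩ ⟨s', c'⟩
    simp only [Matrix.mul_apply, Matrix.conjTranspose_apply, Matrix.of_apply,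
      Fintype.sum_prod_type, star_mul', mul_mul_mul_comm, ← Finset.mul_sum, weyl_isometry,
      Matrix.one_apply, Prod.mk.injEq]
    rw [← Finset.sum_mul, productBasis_complete]
    split_ifs <;> simp_all
  -- A coherent Bell measurement: the label found is kept in `B1` along with the unselected halves.
  V := Matrix.of fun p q =>
    if (Equiv.funSplitAt p.1.1 (Fin m)).symm (p.2, p.1.2) = q.1.1 then
      star (weyl p.1.1 q.2 q.1.2) * (((√(d : ℝ))⁻¹ : ℝ) : ℂ) else 0
  isometry_V := by
    have hd : (d : ℂ) ≠ 0 := NeZero.ne _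
    have hd2 : (((√(d : ℝ))⁻¹ : ℝ) : ℂ) * (((√(d : ℝ))⁻¹ : ℝ) : ℂ) = (d : ℂ)⁻¹ := by
      rw [← Complex.ofReal_mul, ← mul_inv, Real.mul_self_sqrt (Nat.cast_nonneg d)]
      simp
    ext ⟨⟨y, c⟩, μ⟩ ⟨⟨y', c'⟩, μ'⟩
    have h : ∀ l : ZMod d × ZMod d, (∑ y'' : ZMod d × ZMod d → Fin m,
        star (if y'' = y then star (weyl l μ c) * (((√(d : ℝ))⁻¹ : ℝ) : ℂ) else 0) *
          (if y'' = y' then star (weyl l μ' c') * (((√(d : ℝ))⁻¹ : ℝ) : ℂ) else 0)) =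
        (weyl l μ c * star (weyl l μ' c')) * (if y = y' then (d : ℂ)⁻¹ else 0) := by
      intro l
      rw [Finset.sum_eq_single y]
      · rw [if_pos rfl]
        split_ifs
        · rw [star_mul', star_star, mul_mul_mul_comm, ← hd2]
          simp
        · simp
      · intro y'' _ hy; simp [hy]
      · simp
    simp only [Matrix.mul_apply, Matrix.conjTranspose_apply, Matrix.of_apply]
    rw [Fintype.sum_prod_type, Fintype.sum_sigma]
    calc _ = ∑ l : ZMod d × ZMod d, ∑ y'' : ZMod d × ZMod d → Fin m,
        star (if y'' = y then star (weyl l μ c) * (((√(d : ℝ))⁻¹ : ℝ) : ℂ) else 0) *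
          (if y'' = y' then star (weyl l μ' c') * (((√(d : ℝ))⁻¹ : ℝ) : ℂ) else 0) :=
          Finset.sum_congr rfl fun l _ => sum_funSplitAt_symm l fun y'' => star
            (if y'' = y then star (weyl l μ c) * (((√(d : ℝ))⁻¹ : ℝ) : ℂ) else 0) *
            (if y'' = y' then star (weyl l μ' c') * (((√(d : ℝ))⁻¹ : ℝ) : ℂ) else 0)
      _ = _ := by
        simp_rw [h]
        rw [← Finset.sum_mul, weyl_complete, Matrix.one_apply]
        simp only [Prod.mk.injEq]
        split_ifs <;> simp_all

variable (b : X → OrthonormalBasis (Fin m) ℂ (EuclideanSpace ℂ (Fin m)))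
  (t : X → (ZMod d × ZMod d → Fin m) → ZMod d × ZMod d)

theorem measureAndSelect_afterAlice (x : X) (u : ZMod d × ZMod d → Fin m) (μ : ZMod d)
    (e : (ZMod d × ZMod d → Fin m) × ZMod d) :
    (measureAndSelect b t).afterAlice x u μ e =
      productBasis (b x) u e.1 * weyl (t x u) μ e.2 *
        (((√((m : ℝ) ^ (d * d) * d))⁻¹ : ℝ) : ℂ) := by
  simp only [OneWayProtocol.afterAlice, measureAndSelect, Matrix.of_apply]
  rw [Finset.sum_eq_single e]
  · simp
  · intro s _ hs; simp [hs]
  · exact fun h => absurd (Finset.mem_univ e) h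

/-- The amplitude contains the trace inner product of two Weyl operators, which is `d` or `0`; this
`d` cancels the `1/√d` of `V` and the `1/√d` of the coding pair. -/
theorem measureAndSelect_finalState (x : X) (u : ZMod d × ZMod d → Fin m)
    (l : ZMod d × ZMod d) (z : {l' // l' ≠ l} → Fin m) (o : Fin m) :
    (measureAndSelect b t).finalState x u ⟨l, z⟩ o =
      if l = t x u then productBasis (b x) u ((Equiv.funSplitAt l (Fin m)).symm (o, z)) *
        (((√((m : ℝ) ^ (d * d)))⁻¹ : ℝ) : ℂ) else 0 := by
  have hd : (0 : ℝ) < d := by exact_mod_cast Nat.pos_of_neZero d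
  have hN : (√((m : ℝ) ^ (d * d)))⁻¹ = d * ((√(d : ℝ))⁻¹ * (√((m : ℝ) ^ (d * d) * d))⁻¹) := by
    rw [Real.sqrt_mul (by positivity), mul_inv, mul_comm _ (√(d : ℝ))⁻¹, ← mul_assoc, ← mul_assoc,
      mul_assoc (d : ℝ), ← mul_inv, Real.mul_self_sqrt hd.le, mul_inv_cancel₀ hd.ne', one_mul]
  have key : (measureAndSelect b t).finalState x u ⟨l, z⟩ o =
      ∑ c, ∑ μ, (star (weyl l μ c) * (((√(d : ℝ))⁻¹ : ℝ) : ℂ)) *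
        (productBasis (b x) u ((Equiv.funSplitAt l (Fin m)).symm (o, z)) *
          weyl (t x u) μ c * (((√((m : ℝ) ^ (d * d) * d))⁻¹ : ℝ) : ℂ)) := by
    have h : (measureAndSelect b t).finalState x u ⟨l, z⟩ o =
        ∑ e : (ZMod d × ZMod d → Fin m) × ZMod d, ∑ μ,
          (if (Equiv.funSplitAt l (Fin m)).symm (o, z) = e.1 then
            star (weyl l μ e.2) * (((√(d : ℝ))⁻¹ : ℝ) : ℂ) else 0) *
          (productBasis (b x) u e.1 * weyl (t x u) μ e.2 *
            (((√((m : ℝ) ^ (d * d) * d))⁻¹ : ℝ) : ℂ)) :=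
      Finset.sum_congr rfl fun e _ => Finset.sum_congr rfl fun μ _ =>
        congrArg _ (measureAndSelect_afterAlice b t x u μ e)
    rw [h, Fintype.sum_prod_type,
      Finset.sum_eq_single ((Equiv.funSplitAt l (Fin m)).symm (o, z))]
    · simp only [if_true]
    · intro y _ hy
      simp only [hy.symm, if_false, zero_mul, Finset.sum_const_zero]
    · simp
  have hT := weyl_trace_orthogonal l (t x u)
  rw [key, hN]
  calc _ = (∑ c, ∑ μ, star (weyl l μ c) * weyl (t x u) μ c) *
        (productBasis (b x) u ((Equiv.funSplitAt l (Fin m)).symm (o, z)) *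
          ((((√(d : ℝ))⁻¹ : ℝ) : ℂ) * (((√((m : ℝ) ^ (d * d) * d))⁻¹ : ℝ) : ℂ))) := by
        simp_rw [Finset.sum_mul]
        refine Finset.sum_congr rfl fun c _ => Finset.sum_congr rfl fun μ _ => ?_
        ring
    _ = _ := by
        rw [hT]
        split_ifs
        · push_cast; ring
        · simp

/-- Tracing out Alice's record `u` leaves a classical mixture over equally likely outcomes, and the
unselected halves trace to `1`. -/
theorem measureAndSelect_output (x : X) :
    (measureAndSelect b t).output x = ((m : ℂ) ^ (d * d))⁻¹ • ∑ u : ZMod d × ZMod d → Fin m,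
      Matrix.vecMulVec (fun r => b x (u (t x u)) r) (fun r => star (b x (u (t x u)) r)) := by
  have hN : (((√((m : ℝ) ^ (d * d)))⁻¹ : ℝ) : ℂ) * (((√((m : ℝ) ^ (d * d)))⁻¹ : ℝ) : ℂ) =
      ((m : ℂ) ^ (d * d))⁻¹ := by
    rw [← Complex.ofReal_mul, ← mul_inv, Real.mul_self_sqrt (by positivity)]
    simp
  ext o o'
  simp only [OneWayProtocol.output, Matrix.of_apply, Matrix.smul_apply, Matrix.sum_apply,
    Matrix.vecMulVec_apply, smul_eq_mul, Finset.mul_sum]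
  refine Finset.sum_congr rfl fun (u : ZMod d × ZMod d → Fin m) _ => ?_
  refine (Fintype.sum_sigma _).trans ?_
  refine (Finset.sum_congr rfl fun l _ => Finset.sum_congr rfl fun z _ =>
    congrArg₂ (fun p q => p * star q) (measureAndSelect_finalState b t x u l z o)
      (measureAndSelect_finalState b t x u l z o')).trans ?_
  rw [Finset.sum_eq_single (t x u)]
  · rw [← sum_productBasis_funSplitAt (b x) u, Finset.mul_sum]
    refine Finset.sum_congr rfl fun z _ => ?_
    rw [if_pos rfl, if_pos rfl, star_mul', mul_mul_mul_comm, ← hN]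
    simp [mul_comm]
  · intro l _ hl; simp [hl]
  · simp

theorem measureAndSelect_communicationCost :
    (measureAndSelect b t).communicationCost = Real.logb 2 d := by
  have : Fintype.card (measureAndSelect b t).M = d := ZMod.card d
  rw [OneWayProtocol.communicationCost, this]

/-- The coefficient matrix is a nonzero scalar, hence of full rank. The coding pair alone gives rank
at least `2`, even when `m = 1`. -/
theorem measureAndSelect_hasSharedEntanglement (hd : 2 ≤ d) :
    (measureAndSelect b t).HasSharedEntanglement := by
  have hm : (0 : ℝ) < m := by exact_mod_cast Nat.pos_of_neZero m
  have hd0 : (0 : ℝ) < d := by exact_mod_cast Nat.pos_of_neZero d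
  have h : (0 : ℝ) < √((m : ℝ) ^ (d * d) * d) := by positivity
  have hN : IsUnit (((√((m : ℝ) ^ (d * d) * d))⁻¹ : ℝ) : ℂ) :=
    (Complex.ofReal_ne_zero.mpr (inv_pos.mpr h).ne').isUnit
  have hφ : (Matrix.of fun s e : (ZMod d × ZMod d → Fin m) × ZMod d =>
      (measureAndSelect b t).φ (s, e)) =
      Matrix.scalar _ (((√((m : ℝ) ^ (d * d) * d))⁻¹ : ℝ) : ℂ) := by
    ext s e
    simp [measureAndSelect, Matrix.diagonal_apply]
  have hr : (measureAndSelect b t).schmidtRank =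
      Fintype.card ((ZMod d × ZMod d → Fin m) × ZMod d) := by
    refine (congrArg Matrix.rank hφ).trans ?_
    exact Matrix.rank_of_isUnit _ (hN.map (Matrix.scalar _))
  rw [OneWayProtocol.HasSharedEntanglement, hr, Fintype.card_prod, ZMod.card]
  have : 0 < Fintype.card (ZMod d × ZMod d → Fin m) := Fintype.card_pos
  nlinarith

end Protocol

/-! ### Trace norm of matrices diagonal in a given basis. -/

section TraceNorm

variable {κ : Type*} [Fintype κ]

/-- The matrix that is diagonal in the orthonormal basis `b`, with diagonal `f`. -/
def diagonalIn (b : OrthonormalBasis κ ℂ (EuclideanSpace ℂ κ)) (f : κ → ℝ) : Matrix κ κ ℂ :=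
  ∑ v, (f v : ℂ) • Matrix.vecMulVec (fun r => b v r) (fun r => star (b v r))

theorem diagonalIn_apply (b : OrthonormalBasis κ ℂ (EuclideanSpace ℂ κ)) (f : κ → ℝ) (r s : κ) :
    diagonalIn b f r s = ∑ v, (f v : ℂ) * (b v r * star (b v s)) := by
  simp [diagonalIn, Matrix.sum_apply, Matrix.vecMulVec_apply]

theorem diagonalIn_conjTranspose (b : OrthonormalBasis κ ℂ (EuclideanSpace ℂ κ)) (f : κ → ℝ) :
    (diagonalIn b f)ᴴ = diagonalIn b f := by
  ext r s
  simp only [Matrix.conjTranspose_apply, diagonalIn_apply, star_sum, star_mul', star_star]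
  refine Finset.sum_congr rfl fun v _ => ?_
  simp [mul_comm]

theorem diagonalIn_sub (b : OrthonormalBasis κ ℂ (EuclideanSpace ℂ κ)) (f g : κ → ℝ) :
    diagonalIn b f - diagonalIn b g = diagonalIn b (f - g) := by
  simp [diagonalIn, sub_smul]

variable [DecidableEq κ]

theorem diagonalIn_mul (b : OrthonormalBasis κ ℂ (EuclideanSpace ℂ κ)) (f g : κ → ℝ) :
    diagonalIn b f * diagonalIn b g = diagonalIn b (f * g) := by
  simp only [diagonalIn, Finset.sum_mul_sum, Matrix.smul_mul, Matrix.mul_smul,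
    Matrix.vecMulVec_mul_vecMulVec]
  refine Finset.sum_congr rfl fun v _ => ?_
  have h : ∀ w, (fun r => star (b v r)) ⬝ᵥ (fun r => b w r) = if v = w then 1 else 0 :=
    fun w => OrthonormalBasis.sum_mul_star b v w
  rw [Finset.sum_eq_single v]
  · rw [h, if_pos rfl, one_smul, smul_smul, Pi.mul_apply, Complex.ofReal_mul, mul_comm]
  · intro w _ hw; rw [h]; simp [hw.symm]
  · simp

theorem diagonalIn_trace (b : OrthonormalBasis κ ℂ (EuclideanSpace ℂ κ)) (f : κ → ℝ) :
    (diagonalIn b f).trace = ∑ v, (f v : ℂ) := by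
  rw [diagonalIn, Matrix.trace_sum]
  refine Finset.sum_congr rfl fun v _ => ?_
  rw [Matrix.trace_smul, Matrix.trace_vecMulVec, dotProduct_comm]
  have : (fun r => star (b v r)) ⬝ᵥ (fun r => b v r) = 1 :=
    (OrthonormalBasis.sum_mul_star b v v).trans (if_pos rfl)
  rw [this]; simp

open scoped ComplexOrder in
theorem diagonalIn_posSemidef (b : OrthonormalBasis κ ℂ (EuclideanSpace ℂ κ)) {f : κ → ℝ}
    (hf : 0 ≤ f) : (diagonalIn b f).PosSemidef := by
  have h : diagonalIn b f = (diagonalIn b fun v => √(f v))ᴴ * diagonalIn b fun v => √(f v) := by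
    rw [diagonalIn_conjTranspose, diagonalIn_mul]
    congr 1; ext v
    exact (Real.mul_self_sqrt (hf v)).symm
  rw [h]
  exact Matrix.posSemidef_conjTranspose_mul_self _

/-- Target and output are diagonal in the same basis, so this reduces the error to a classical `ℓ¹`
distance. -/
theorem traceNorm_diagonalIn (b : OrthonormalBasis κ ℂ (EuclideanSpace ℂ κ)) (f : κ → ℝ) :
    traceNorm (diagonalIn b f) = ∑ v, |f v| := by
  open scoped MatrixOrder in
  have h : CFC.sqrt ((diagonalIn b f)ᴴ * diagonalIn b f) = diagonalIn b fun v => |f v| := by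
    refine CFC.sqrt_unique ?_ ?_
    · rw [diagonalIn_conjTranspose, diagonalIn_mul, diagonalIn_mul]
      congr 1; ext v
      exact abs_mul_abs_self (f v)
    · exact (diagonalIn_posSemidef b fun v => abs_nonneg (f v)).nonneg
  rw [traceNorm, h, diagonalIn_trace, ← Complex.ofReal_sum, Complex.ofReal_re]

/-- A uniform mixture of basis vectors, indexed by `u : β`. -/
theorem smul_sum_vecMulVec_eq_diagonalIn {β : Type*} [Fintype β]
    (b : OrthonormalBasis κ ℂ (EuclideanSpace ℂ κ)) (c : ℝ) (g : β → κ) :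
    (c : ℂ) • ∑ u, Matrix.vecMulVec (fun r => b (g u) r) (fun r => star (b (g u) r)) =
      diagonalIn b fun v => c * (Finset.univ.filter fun u => g u = v).card := by
  rw [diagonalIn, ← Finset.sum_fiberwise Finset.univ g, Finset.smul_sum]
  refine Finset.sum_congr rfl fun v _ => ?_
  rw [Finset.sum_congr rfl (g := fun _ =>
    Matrix.vecMulVec (fun r => b v r) (fun r => star (b v r)))]
  · rw [Finset.sum_const, ← Nat.cast_smul_eq_nsmul ℂ, smul_smul]
    simp
  · intro u hu
    rw [(Finset.mem_filter.mp hu).2]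

end TraceNorm

/-! ### Distribution of the selected outcome. -/

section Select

variable {ι κ : Type*} [Nonempty ι]

open Classical in
/-- A member of the set `S` of labels, provided `S` is nonempty. -/
def pick (S : Set ι) : ι := if h : S.Nonempty then h.some else Classical.arbitrary ι

theorem pick_mem {S : Set ι} (h : S.Nonempty) : pick S ∈ S := by
  rw [pick, dif_pos h]; exact h.some_mem

variable (A : Finset κ)

/-- The label selected from the outcomes `u`: one whose outcome lies in `A`, if there is any. -/
def selectIn (u : ι → κ) : ι := pick {l | u l ∈ A}

theorem selectIn_mem_iff (u : ι → κ) : u (selectIn A u) ∈ A ↔ ∃ l, u l ∈ A :=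
  ⟨fun h => ⟨_, h⟩, fun h => pick_mem (S := {l | u l ∈ A}) h⟩

variable [Fintype ι] [DecidableEq ι] [Fintype κ] [DecidableEq κ]

/-- `selectIn` sees only which labels have outcomes in `A`, so swapping `v` and `w` in every outcome
leaves the selection unchanged. -/
theorem card_selectIn_eq {v w : κ} (hv : v ∈ A) (hw : w ∈ A) :
    (Finset.univ.filter fun u : ι → κ => u (selectIn A u) = v).card =
      (Finset.univ.filter fun u : ι → κ => u (selectIn A u) = w).card := by
  have hmem : ∀ a, Equiv.swap v w a ∈ A ↔ a ∈ A := by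
    intro a
    rcases eq_or_ne a v with rfl | h1
    · simp [hv, hw]
    rcases eq_or_ne a w with rfl | h2
    · simp [hv, hw]
    rw [Equiv.swap_apply_of_ne_of_ne h1 h2]
  have hsel : ∀ u : ι → κ, selectIn A (fun l => Equiv.swap v w (u l)) = selectIn A u := by
    intro u; simp [selectIn, hmem]
  refine Finset.card_bij (fun u _ l => Equiv.swap v w (u l)) ?_ ?_ ?_
  · intro u hu
    simp only [Finset.mem_filter, Finset.mem_univ, true_and] at hu ⊢
    rw [hsel, hu, Equiv.swap_apply_left]
  · intro u _ u' _ h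
    funext l
    exact (Equiv.swap v w).injective (congrFun h l)
  · intro u hu
    refine ⟨fun l => Equiv.swap v w (u l), ?_, by funext l; simp⟩
    simp only [Finset.mem_filter, Finset.mem_univ, true_and] at hu ⊢
    rw [hsel, hu, Equiv.swap_apply_right]

theorem card_selectIn_not_mem :
    (Finset.univ.filter fun u : ι → κ => u (selectIn A u) ∉ A).card =
      Aᶜ.card ^ Fintype.card ι := by
  rw [← Finset.card_univ, ← Finset.prod_const, ← Fintype.card_piFinset]
  congr 1; ext u
  simp [selectIn_mem_iff]

/-- The distance of the distribution of the selected outcome to the uniform distribution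
on `A`. -/
theorem sum_abs_uniform_sub_selectIn (hA : A.Nonempty) :
    ∑ v, |(if v ∈ A then (A.card : ℝ)⁻¹ else 0) -
        ((Fintype.card κ : ℝ) ^ Fintype.card ι)⁻¹ *
          (Finset.univ.filter fun u : ι → κ => u (selectIn A u) = v).card| =
      2 * ((Aᶜ.card : ℝ) / Fintype.card κ) ^ Fintype.card ι := by
  set N : ℝ := (Fintype.card κ : ℝ) ^ Fintype.card ι with hN
  set q : κ → ℝ := fun v => (Finset.univ.filter fun u : ι → κ => u (selectIn A u) = v).card with hq
  set F : ℝ := (Aᶜ.card : ℝ) ^ Fintype.card ι with hF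
  have : Nonempty κ := ⟨hA.choose⟩
  have hκ : (0 : ℝ) < Fintype.card κ := by exact_mod_cast Fintype.card_pos
  have hN0 : 0 < N := by positivity
  have hA0 : (0 : ℝ) < A.card := by exact_mod_cast hA.card_pos
  have hFN : F ≤ N := by
    have : (Aᶜ.card : ℝ) ≤ Fintype.card κ := by exact_mod_cast Finset.card_le_univ _
    exact pow_le_pow_left₀ (Nat.cast_nonneg _) this _
  have hout : ∑ v ∈ Aᶜ, q v = F := by
    rw [hF, ← Nat.cast_pow, ← card_selectIn_not_mem, hq, ← Nat.cast_sum,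
      Finset.card_eq_sum_card_fiberwise (f := fun u => u (selectIn A u)) (t := Aᶜ)]
    · congr 1
      refine Finset.sum_congr rfl fun v hv => ?_
      congr 1; ext u
      simp only [Finset.mem_filter, Finset.mem_univ, true_and]
      refine ⟨fun h => ⟨?_, h⟩, fun h => h.2⟩
      rw [h]; simpa using hv
    · intro u hu; simpa using hu
  have htot : ∑ v, q v = N := by
    rw [hq, ← Nat.cast_sum, ← Finset.card_eq_sum_card_fiberwise (s := Finset.univ)
      (t := Finset.univ) (f := fun u : ι → κ => u (selectIn A u)) (fun _ _ => by simp)]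
    simp [hN]
  have hin : ∑ v ∈ A, q v = N - F := by
    rw [← htot, ← hout, ← Finset.sum_add_sum_compl A]; ring
  have hqv : ∀ v ∈ A, q v = (N - F) / A.card := by
    intro v hv
    rw [eq_div_iff hA0.ne', ← hin, Finset.sum_congr rfl fun w hw =>
      show q w = q v by simp only [hq]; exact_mod_cast card_selectIn_eq A hw hv]
    rw [Finset.sum_const, nsmul_eq_mul, mul_comm]
  have hdiv : ((Aᶜ.card : ℝ) / Fintype.card κ) ^ Fintype.card ι = F / N := div_pow _ _ _
  rw [hdiv, ← Finset.sum_add_sum_compl A]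
  -- The failure probability `F / N` is counted twice: as mass missing from `A`, here, and as mass
  -- outside `A`, in `h2`.
  have h1 : ∑ v ∈ A, |(if v ∈ A then (A.card : ℝ)⁻¹ else 0) - N⁻¹ * q v| = F / N := by
    rw [Finset.sum_congr rfl (g := fun _ => F / N / A.card), Finset.sum_const, nsmul_eq_mul,
      mul_div_cancel₀ _ hA0.ne']
    intro v hv
    rw [if_pos hv, hqv v hv, ← abs_of_nonneg (a := F / N / A.card) (by positivity)]
    congr 1
    field_simp
    ring
  have h2 : ∑ v ∈ Aᶜ, |(if v ∈ A then (A.card : ℝ)⁻¹ else 0) - N⁻¹ * q v| = F / N := by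
    rw [div_eq_inv_mul, ← hout, Finset.mul_sum]
    refine Finset.sum_congr rfl fun v hv => ?_
    rw [if_neg (by simpa using hv), zero_sub, abs_neg, abs_of_nonneg (by positivity)]
  rw [h1, h2]; ring

end Select

/-! ### Exact error of the protocol on the ensemble. -/

section Ensemble

variable {k m n d : ℕ} [NeZero m] [NeZero d]

/-- The `j`-th block of the `i`-th basis, as a set of indices. -/
def JRSEnsemble.blockSet (E : JRSEnsemble k m n) (x : Fin (n / k) × Fin k) : Finset (Fin m) :=
  Finset.univ.filter fun v => E.block x.1 v = x.2

/-- The `measureAndSelect` protocol for an ensemble: Alice selects a pair whose measurement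
outcome lies in the block of her input. -/
def JRSEnsemble.protocol (E : JRSEnsemble k m n) (d : ℕ) [NeZero d] :
    OneWayProtocol (Fin (n / k) × Fin k) (Fin m) :=
  measureAndSelect (d := d) (fun x => E.basis x.1) fun x => selectIn (E.blockSet x)

theorem JRSEnsemble.state_eq_diagonalIn (E : JRSEnsemble k m n) (x : Fin (n / k) × Fin k) :
    E.state x = diagonalIn (E.basis x.1)
      fun v => if v ∈ E.blockSet x then ((E.blockSet x).card : ℝ)⁻¹ else 0 := by
  have hm : (m : ℝ) ≠ 0 := NeZero.ne _
  have hc : (k : ℝ) * (E.blockSet x).card = m := by exact_mod_cast E.card_block x.1 x.2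
  have hk : (k : ℝ) ≠ 0 := by rintro h; rw [h, zero_mul] at hc; exact hm hc.symm
  have h : ((E.blockSet x).card : ℝ)⁻¹ = k / m := by rw [← hc]; field_simp
  rw [JRSEnsemble.state, diagonalIn, h, Finset.smul_sum, Finset.sum_filter]
  refine Finset.sum_congr rfl fun v _ => ?_
  simp only [JRSEnsemble.blockSet, Finset.mem_filter, Finset.mem_univ, true_and]
  split_ifs <;> simp

theorem JRSEnsemble.traceNorm_state_sub_output (E : JRSEnsemble k m n)
    (x : Fin (n / k) × Fin k) :
    traceNorm (E.state x - (E.protocol d).output x) = 2 * (1 - 1 / (k : ℝ)) ^ (d * d) := by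
  have hm : (m : ℝ) ≠ 0 := NeZero.ne _
  have hc : (k : ℝ) * (E.blockSet x).card = m := by exact_mod_cast E.card_block x.1 x.2
  have hk : (k : ℝ) ≠ 0 := by rintro h; rw [h, zero_mul] at hc; exact hm hc.symm
  have hA : (E.blockSet x).Nonempty := by
    rw [Finset.nonempty_iff_ne_empty]
    rintro h; rw [h] at hc; exact hm (by simpa using hc.symm)
  have hout : (E.protocol d).output x = diagonalIn (E.basis x.1) fun v =>
      ((m : ℝ) ^ (d * d))⁻¹ * (Finset.univ.filter fun u : ZMod d × ZMod d → Fin m =>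
        u (selectIn (E.blockSet x) u) = v).card := by
    rw [← smul_sum_vecMulVec_eq_diagonalIn, JRSEnsemble.protocol, measureAndSelect_output]
    simp
  have hsum := sum_abs_uniform_sub_selectIn (ι := ZMod d × ZMod d) _ hA
  have hfrac : ((E.blockSet x)ᶜ.card : ℝ) / m = 1 - 1 / k := by
    rw [Finset.card_compl, Fintype.card_fin, Nat.cast_sub (by
      simpa using Finset.card_le_univ (E.blockSet x)), ← hc]
    have : ((E.blockSet x).card : ℝ) ≠ 0 := by exact_mod_cast hA.card_pos.ne'
    field_simp
  simp only [Fintype.card_fin, Fintype.card_prod, ZMod.card, hfrac] at hsum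
  rw [E.state_eq_diagonalIn, hout, diagonalIn_sub, traceNorm_diagonalIn, ← hsum]
  rfl

theorem JRSEnsemble.protocol_averageError (E : JRSEnsemble k m n) (hn : 0 < n) (hkn : k ∣ n) :
    (E.protocol d).averageError (fun _ => 1 / (n : ℝ)) E.state =
      2 * (1 - 1 / (k : ℝ)) ^ (d * d) := by
  have hn' : (n : ℝ) ≠ 0 := by positivity
  simp only [OneWayProtocol.averageError, E.traceNorm_state_sub_output]
  rw [Finset.sum_const, Finset.card_univ, Fintype.card_prod, Fintype.card_fin, Fintype.card_fin,
    Nat.div_mul_cancel hkn, nsmul_eq_mul]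
  field_simp

end Ensemble

/-! ### Choice of `d`: error and cost estimates. -/

/-- With `Y = max 4 (1 / ε)`, the power is at most `exp (-T / k) ≤ Y⁻²`, and `2 Y⁻² ≤ Y⁻¹ ≤ ε` since
`Y ≥ 4`. -/
theorem two_mul_one_sub_inv_pow_le {k T : ℕ} {ε : ℝ} (hk : 0 < k) (hε : 0 < ε)
    (hT : 2 * k * Real.logb 2 (max 4 (1 / ε)) ≤ T) : 2 * (1 - 1 / (k : ℝ)) ^ T ≤ ε := by
  set Y : ℝ := max 4 (1 / ε) with hY
  have hY4 : 4 ≤ Y := le_max_left _ _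
  have hYε : Y⁻¹ ≤ ε := by
    rw [inv_le_comm₀ (by linarith) hε, ← one_div]; exact le_max_right _ _
  have hY4' : Y⁻¹ ≤ 4⁻¹ := inv_anti₀ (by norm_num) hY4
  have hk0 : (0 : ℝ) < k := by exact_mod_cast hk
  have hk1 : (1 : ℝ) ≤ k := by exact_mod_cast hk
  have h0 : 0 ≤ 1 - 1 / (k : ℝ) := by
    rw [sub_nonneg, div_le_one hk0]; exact hk1
  have hL : Real.log Y ≤ Real.logb 2 Y := by
    rw [Real.logb, le_div_iff₀ (Real.log_pos (by norm_num))]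
    have : 0 ≤ Real.log Y := Real.log_nonneg (by linarith)
    nlinarith [Real.log_two_lt_d9]
  have hexp : (1 - 1 / (k : ℝ)) ^ T ≤ Y⁻¹ * Y⁻¹ := by
    calc (1 - 1 / (k : ℝ)) ^ T ≤ (Real.exp (-(1 / k))) ^ T :=
          pow_le_pow_left₀ h0 (Real.one_sub_le_exp_neg _) T
      _ = Real.exp (-(T / k)) := by rw [← Real.exp_nat_mul]; congr 1; ring
      _ ≤ Real.exp (-Real.log Y + -Real.log Y) := by
          rw [Real.exp_le_exp]
          have : 2 * Real.logb 2 Y ≤ T / k := by rw [le_div_iff₀ hk0]; linarith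
          linarith
      _ = Y⁻¹ * Y⁻¹ := by
          rw [Real.exp_add, Real.exp_neg, Real.exp_log (by linarith)]
  have : 0 < Y⁻¹ := inv_pos.mpr (by linarith)
  nlinarith

/-- Rounding up at most doubles a number that is at least `1`. The resulting constant `3/2` is
absorbed because `log L ≥ 1`, which is where the coefficient `2` comes from. -/
theorem logb_ceil_sqrt_le {k : ℕ} {L : ℝ} (hk : 0 < k) (hL : 2 ≤ L) :
    Real.logb 2 ⌈√(2 * k * L)⌉₊ ≤ 1 / 2 * Real.logb 2 k + 2 * Real.logb 2 L := by
  have hk1 : (1 : ℝ) ≤ k := by exact_mod_cast hk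
  have h4 : (4 : ℝ) ≤ 2 * k * L := by nlinarith
  have hs : 1 ≤ √(2 * k * L) := Real.one_le_sqrt.mpr (by linarith)
  have hc : (⌈√(2 * k * L)⌉₊ : ℝ) ≤ √(8 * k * L) := by
    have h2 : √(8 * k * L) = 2 * √(2 * k * L) := by
      rw [show 8 * (k : ℝ) * L = 2 ^ 2 * (2 * k * L) by ring, Real.sqrt_mul (by positivity),
        Real.sqrt_sq (by norm_num)]
    have := (Nat.ceil_lt_add_one (Real.sqrt_nonneg (2 * k * L))).le
    linarith
  have hpos : (0 : ℝ) < ⌈√(2 * k * L)⌉₊ := by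
    have := Nat.le_ceil (√(2 * k * L)); linarith
  have hlogL : 1 ≤ Real.logb 2 L := by
    rw [Real.le_logb_iff_rpow_le (by norm_num) (by linarith)]; simpa using hL
  calc Real.logb 2 ⌈√(2 * k * L)⌉₊ ≤ Real.logb 2 √(8 * k * L) :=
        Real.logb_le_logb_of_le (by norm_num) hpos hc
    _ = 1 / 2 * (3 + Real.logb 2 k + Real.logb 2 L) := by
        rw [Real.sqrt_eq_rpow, Real.logb_rpow_eq_mul_logb_of_pos (by positivity),
          Real.logb_mul (by positivity) (by positivity),
          Real.logb_mul (by positivity) (by positivity),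
          show (8 : ℝ) = 2 ^ (3 : ℝ) by norm_num, Real.logb_rpow (by norm_num) (by norm_num)]
    _ ≤ _ := by linarith

end

theorem proposition5 :
    ∃ C : ℝ, 0 < C ∧
      ∀ (k m n : ℕ), 0 < k → 0 < m → 0 < n → k ∣ m → k ∣ n →
      ∀ (ε : ℝ), 0 < ε → ∀ E : JRSEnsemble k m n,
        ∃ P : OneWayProtocol (Fin (n / k) × Fin k) (Fin m),
          P.HasSharedEntanglement ∧
          P.communicationCost ≤
            (1 / 2) * Real.logb 2 k + C * Real.logb 2 (Real.logb 2 (max 4 (1 / ε))) ∧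
          P.averageError (fun _ => 1 / (n : ℝ)) E.state ≤ ε := by
  refine ⟨2, by norm_num, fun k m n hk hm hn _ hkn ε hε E => ?_⟩
  set L : ℝ := Real.logb 2 (max 4 (1 / ε)) with hLdef
  have hL : 2 ≤ L := by
    rw [hLdef, Real.le_logb_iff_rpow_le (by norm_num) (by positivity)]
    exact (by norm_num : (2 : ℝ) ^ (2 : ℝ) ≤ 4).trans (le_max_left _ _)
  have hk1 : (1 : ℝ) ≤ k := by exact_mod_cast hk
  have hle : √(2 * k * L) ≤ ⌈√(2 * k * L)⌉₊ := Nat.le_ceil _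
  -- `2kL ≥ 4` ensures `d ≥ 2`, hence genuine entanglement even for `k = 1`.
  have hsqrt : 2 ≤ √(2 * k * L) := Real.le_sqrt_of_sq_le (by nlinarith)
  have hd : 2 ≤ ⌈√(2 * k * L)⌉₊ := by exact_mod_cast hsqrt.trans hle
  have : NeZero m := ⟨hm.ne'⟩
  have : NeZero ⌈√(2 * k * L)⌉₊ := ⟨by omega⟩
  refine ⟨E.protocol ⌈√(2 * k * L)⌉₊, measureAndSelect_hasSharedEntanglement _ _ hd, ?_, ?_⟩
  · rw [JRSEnsemble.protocol, measureAndSelect_communicationCost]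
    exact logb_ceil_sqrt_le hk hL
  · rw [E.protocol_averageError hn hkn]
    refine two_mul_one_sub_inv_pow_le hk hε ?_
    rw [Nat.cast_mul, ← hLdef]
    calc 2 * k * L = √(2 * k * L) * √(2 * k * L) := (Real.mul_self_sqrt (by positivity)).symm
      _ ≤ _ := by gcongr
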